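/- **Conventions.** An (oriented) conditional rule over a signature $\mathcal F$ and variables $\mathcal V$ is $\alpha: l \to r \Leftarrow s_1 \to^* t_1,\dots,s_k\to^* t_k$ ($k\ge 0$; unconditional if $k=0$); a CTRS $\mathcal R$ is a set of such rules and $\mathcal T$ is the set of terms over $\mathcal F$ and $\mathcal V$. Put $\mathcal R_0=\emptyset$, $\mathcal R_{n+1}=\{l\sigma\to r\sigma \mid (l\to r\Leftarrow c)\in\mathcal R,\ s\sigma\to^*_{\mathcal R_n}t\sigma \text{ for all } s\to^* t \text{ in } c\}$, and let $u\to_{\mathcal R}v$ mean $u\to_{\mathcal R_n}v$ for some $n$; let $\mathcal R_u=\{l\to r\mid (l\to r\Leftarrow c)\in\mathcal R\}$. $\mathcal R$ is a *DCTRS* if for all its rules $\mathrm{Var}(r)\subseteq\mathrm{Var}(l,s_1,t_1,\dots,s_k,t_k)$ and $\mathrm{Var}(s_i)\subseteq\mathrm{Var}(l,t_1,\dots,t_{i-1})$ for all $i$. It is *right-stable* if for all its rules and all $i$, $t_i$ is a linear constructor term or a ground $\mathcal R_u$-irreducible term (constructors being the symbols that are not the root of any left-hand side), and $\mathrm{Var}(t_i)\cap\mathrm{Var}(l,s_1,t_1,\dots,s_{i-1},t_{i-1},s_i)=\emptyset$.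 For a rule $\alpha$ with $k\ge1$ conditions let $X_i=\mathrm{Var}(l,t_1,\dots,t_{i-1})$, let $\vec{X_i}$ list $X_i$ in an arbitrary but fixed order, and let $U^\alpha_1,\dots,U^\alpha_k$ be fresh function symbols. The *sequential unraveling* $\mathbb U_{seq}(\mathcal R)$ is the TRS that consists of the unconditional rules of $\mathcal R$ and, for every conditional rule $\alpha$, the rules $$l\to U^\alpha_1(s_1,\vec{X_1}),\qquad U^\alpha_i(t_i,\vec{X_i})\to U^\alpha_{i+1}(s_{i+1},\vec{X_{i+1}})\ (1\le i<k),\qquad U^\alpha_k(t_k,\vec{X_k})\to r .$$ The *back-translation* $\mathsf{tb}$ maps terms over the extended signature to $\mathcal T$: $\mathsf{tb}(x)=x$ for variables $x$, $\mathsf{tb}(f(s_1,\dots,s_m))=f(\mathsf{tb}(s_1),\dots,\mathsf{tb}(s_m))$ for $f\in\mathcal F$, and $\mathsf{tb}(U^\alpha_i(w,v_1,\dots,v_m))=l\sigma$, where $l$ is the left-hand side of $\alpha$, $\vec{X_i}=x_1,\dots,x_m$ and $x_j\sigma=\mathsf{tb}(v_j)$. A derivation is *innermost* if in every step all proper subterms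 of the contracted redex are irreducible. **Theorem (soundness of innermost derivations).** Let $\mathcal R$ be a right-stable DCTRS and let $u\in\mathcal T$. If there is an innermost derivation $u\to^*v$ in $\mathbb U_{seq}(\mathcal R)$, where $v$ is a term over the extended signature, then $u\to^*_{\mathcal R}\mathsf{tb}(v)$. In particular, if $u,v\in\mathcal T$ and there is an innermost derivation $u\to^*v$ in $\mathbb U_{seq}(\mathcal R)$, then $u\to^*_{\mathcal R}v$. -/

import Mathlib

open FirstOrder

universe u v w

namespace CondRew

section Terms

variable {L : FirstOrder.Language.{u, v}} {V : Type w}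

/-- A set of (unconditional) rewrite rules `l → r`, as pairs of terms. -/
abbrev TRS (L : FirstOrder.Language.{u, v}) (V : Type w) := Set (L.Term V × L.Term V)

/-- `Replace ρ s t`: for some position `p` of `s`, the term `t` is `s[t']_p` for some `t'` with
`ρ (s|_p) t'`. -/
inductive Replace (ρ : L.Term V → L.Term V → Prop) : L.Term V → L.Term V → Prop
  | here {s t : L.Term V} (h : ρ s t) : Replace ρ s t
  | inside {n : ℕ} (f : L.Functions n) (ts : Fin n → L.Term V) (i : Fin n) {t : L.Term V}
      (h : Replace ρ (ts i) t) :
      Replace ρ (.func f ts) (.func f (Function.update ts i t))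

/-- `ProperSubterm s t`: `s` is a proper subterm of `t`. -/
inductive ProperSubterm : L.Term V → L.Term V → Prop
  | arg {n : ℕ} (f : L.Functions n) (ts : Fin n → L.Term V) (i : Fin n) :
      ProperSubterm (ts i) (.func f ts)
  | deeper {n : ℕ} (f : L.Functions n) (ts : Fin n → L.Term V) (i : Fin n) {s : L.Term V}
      (h : ProperSubterm s (ts i)) : ProperSubterm s (.func f ts)

/-- A rewrite step at the root: `s = lσ` and `t = rσ` for a rule `l → r` and a substitution `σ`. -/
def RootStep (R : TRS L V) (s t : L.Term V) : Prop :=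
  ∃ rule ∈ R, ∃ σ : V → L.Term V, s = rule.1.subst σ ∧ t = rule.2.subst σ

/-- One rewrite step of a TRS. -/
def Step (R : TRS L V) : L.Term V → L.Term V → Prop := Replace (RootStep R)

/-- The term `t` is irreducible (a normal form). -/
def Irreducible (R : TRS L V) (t : L.Term V) : Prop := ∀ t', ¬ Step R t t'

/-- One innermost rewrite step: all proper subterms of the contracted redex are irreducible. -/
def InnermostStep (R : TRS L V) : L.Term V → L.Term V → Prop :=
  Replace fun s t => RootStep R s t ∧ ∀ w, ProperSubterm w s → Irreducible R w

/-- `t` is linear: no variable occurs twice in `t`. -/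
def Linear [DecidableEq V] : L.Term V → Prop
  | .var _ => True
  | .func _ ts => (∀ i, Linear (ts i)) ∧
      ∀ i j, i ≠ j → Disjoint (ts i).varFinset (ts j).varFinset

/-- `t` is ground: it contains no variables. -/
def Ground [DecidableEq V] (t : L.Term V) : Prop := t.varFinset = ∅

/-- An oriented conditional rule `lhs → rhs ⇐ s₁ →* t₁, …, sₖ →* tₖ`; the list `conds` consists of
the pairs `(sᵢ, tᵢ)`. The rule is unconditional if this list is empty. -/
structure CRule (L : FirstOrder.Language.{u, v}) (V : Type w) where
  lhs : L.Term V
  rhs : L.Term V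
  conds : List (L.Term V × L.Term V)

/-- A conditional term rewrite system. -/
abbrev CTRS (L : FirstOrder.Language.{u, v}) (V : Type w) := Set (CRule L V)

/-- The underlying TRS, obtained by dropping all conditions. -/
def CTRS.underlying (R : CTRS L V) : TRS L V :=
  {p | ∃ α ∈ R, p = (α.lhs, α.rhs)}

/-- The TRSs `R₀ = ∅` and
`Rₙ₊₁ = {lσ → rσ | l → r ⇐ c ∈ R and sσ →* tσ in Rₙ for all s →* t in c}`. -/
def CTRS.level (R : CTRS L V) : ℕ → TRS L V
  | 0 => ∅
  | n + 1 => {p | ∃ α ∈ R, ∃ σ : V → L.Term V,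
      (∀ c ∈ α.conds, Relation.ReflTransGen (Step (CTRS.level R n)) (c.1.subst σ) (c.2.subst σ)) ∧
      p = (α.lhs.subst σ, α.rhs.subst σ)}

/-- One rewrite step of a CTRS. -/
def CTRS.CStep (R : CTRS L V) (s t : L.Term V) : Prop := ∃ n, Step (R.level n) s t

/-- Defined symbols are the root symbols of left-hand sides; all others are constructors. -/
def CTRS.IsDefined (R : CTRS L V) {n : ℕ} (f : L.Functions n) : Prop :=
  ∃ α ∈ R, ∃ ts : Fin n → L.Term V, α.lhs = .func f ts

/-- A constructor term consists of constructors and variables only. -/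
def CTRS.IsConstructorTerm (R : CTRS L V) : L.Term V → Prop
  | .var _ => True
  | .func f ts => ¬ R.IsDefined f ∧ ∀ i, CTRS.IsConstructorTerm R (ts i)

variable [DecidableEq V]

/-- All variables of the first `m` conditions. -/
def CRule.condVars (α : CRule L V) (m : ℕ) : Finset V :=
  (α.conds.take m).foldr (fun c X => c.1.varFinset ∪ c.2.varFinset ∪ X) ∅

/-- The variables of the left-hand side and of the right-hand sides of the first `m` conditions.
With conditions numbered from `0`, this is the set `Xᵢ = Var(l, t₀, …, tᵢ₋₁)` at `m = i`. -/
def CRule.bound (α : CRule L V) (m : ℕ) : Finset V :=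
  α.lhs.varFinset ∪ (α.conds.take m).foldr (fun c X => c.2.varFinset ∪ X) ∅

/-- Type 3: all extra variables of the right-hand side occur in the conditions. -/
def CRule.IsType3 (α : CRule L V) : Prop :=
  α.rhs.varFinset ⊆ α.condVars α.conds.length ∪ α.lhs.varFinset

/-- Deterministic conditional rules. -/
def CRule.IsDeterministic (α : CRule L V) : Prop :=
  α.IsType3 ∧
    ∀ (i : ℕ) (h : i < α.conds.length), (α.conds[i]).1.varFinset ⊆ α.bound i

/-- Deterministic CTRSs. -/
def CTRS.IsDCTRS (R : CTRS L V) : Prop := ∀ α ∈ R, α.IsDeterministic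

/-- Right-stability: every `tᵢ` is a linear constructor term or a ground term that is irreducible
for the underlying TRS, and shares no variable with `l, s₀, t₀, …, sᵢ₋₁, tᵢ₋₁, sᵢ`. -/
def CTRS.IsRightStable (R : CTRS L V) : Prop :=
  ∀ α ∈ R, ∀ (i : ℕ) (h : i < α.conds.length),
    ((Linear (α.conds[i]).2 ∧ R.IsConstructorTerm (α.conds[i]).2) ∨
      (Ground (α.conds[i]).2 ∧ Irreducible R.underlying (α.conds[i]).2)) ∧
    Disjoint (α.conds[i]).2.varFinset
      (α.lhs.varFinset ∪ α.condVars i ∪ (α.conds[i]).1.varFinset)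

end Terms

/-- A fixed choice, for every finite set of variables, of an order in which to list it. -/
structure VarOrder (V : Type w) where
  list : Finset V → List V
  nodup : ∀ X, (list X).Nodup
  mem_list : ∀ X x, x ∈ list X ↔ x ∈ X

section Unraveling

variable {L : FirstOrder.Language.{u, v}} {V : Type w} [DecidableEq V]

/-- The U-symbols: one symbol `U^α_i` for every rule `α` of `R` and (the index of) every condition
of `α`. It has a conditional argument (the one at index `0`) and `|Xᵢ|` variable arguments. -/
inductive USym (R : CTRS L V) (ord : VarOrder V) : ℕ → Type (max u w)
  | mk (α : R) (i : Fin α.1.conds.length) : USym R ord ((ord.list (α.1.bound i)).length + 1)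

/-- The signature that consists of the U-symbols. -/
def uLang (R : CTRS L V) (ord : VarOrder V) : FirstOrder.Language.{max u w, 0} where
  Functions := USym R ord
  Relations := fun _ => Empty

/-- Mixed terms: terms over the original signature extended by the U-symbols. -/
abbrev MTerm (R : CTRS L V) (ord : VarOrder V) := (L.sum (uLang R ord)).Term V

/-- Original terms as mixed terms. -/
def orig (R : CTRS L V) (ord : VarOrder V) (t : L.Term V) : MTerm R ord :=
  (FirstOrder.Language.LHom.sumInl : L →ᴸ L.sum (uLang R ord)).onTerm t

/-- The mixed term `U^α_i(a, v₁, …, vₘ)`. -/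
def uApp {R : CTRS L V} (ord : VarOrder V) (α : R) (i : Fin α.1.conds.length) (a : MTerm R ord)
    (vs : Fin (ord.list (α.1.bound i)).length → MTerm R ord) : MTerm R ord :=
  .func (Sum.inr (USym.mk α i)) (Fin.cons a vs)

/-- The mixed term `U^α_i(a, x₁, …, xₘ)`, where `x₁, …, xₘ` lists `Xᵢ`. -/
def uPattern {R : CTRS L V} (ord : VarOrder V) (α : R) (i : Fin α.1.conds.length)
    (a : MTerm R ord) : MTerm R ord :=
  uApp ord α i a fun j => .var ((ord.list (α.1.bound i)).get j)

/-- The rules of the sequential unraveling of a single rule `α`. -/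
inductive UseqRule {R : CTRS L V} (ord : VarOrder V) (α : R) : MTerm R ord → MTerm R ord → Prop
  | unconditional (h : α.1.conds = []) :
      UseqRule ord α (orig R ord α.1.lhs) (orig R ord α.1.rhs)
  | introduction (h : 0 < α.1.conds.length) :
      UseqRule ord α (orig R ord α.1.lhs) (uPattern ord α ⟨0, h⟩ (orig R ord (α.1.conds[0]).1))
  | switch (i : ℕ) (h : i + 1 < α.1.conds.length) :
      UseqRule ord α
        (uPattern ord α ⟨i, Nat.lt_of_succ_lt h⟩ (orig R ord (α.1.conds[i]).2))
        (uPattern ord α ⟨i + 1, h⟩ (orig R ord (α.1.conds[i + 1]).1))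
  | elimination (i : ℕ) (h : i < α.1.conds.length) (hlast : i + 1 = α.1.conds.length) :
      UseqRule ord α (uPattern ord α ⟨i, h⟩ (orig R ord (α.1.conds[i]).2)) (orig R ord α.1.rhs)

/-- The sequential unraveling of a CTRS. -/
def useq (R : CTRS L V) (ord : VarOrder V) : TRS (L.sum (uLang R ord)) V :=
  {p | ∃ α : R, UseqRule ord α p.1 p.2}

/-- The substitution that maps the `j`-th variable of the list `xs` to `ts j`. -/
def bindVars (xs : List V) (ts : Fin xs.length → L.Term V) (x : V) : L.Term V :=
  if h : x ∈ xs then ts ⟨xs.idxOf x, List.idxOf_lt_length_iff.2 h⟩ else .var x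

/-- The back-translation: `U^α_i(a, v₁, …, vₘ)` is mapped to `lσ`, where `l` is the left-hand side
of `α` and `xⱼσ` is the back-translation of `vⱼ` for `Xᵢ = {x₁, …, xₘ}`. -/
def tb {R : CTRS L V} {ord : VarOrder V} : MTerm R ord → L.Term V
  | .var x => .var x
  | .func (.inl f) ts => .func f fun i => tb (ts i)
  | .func (.inr (.mk α i)) ts =>
      α.1.lhs.subst (bindVars (ord.list (α.1.bound i)) fun j => tb (ts j.succ))

end Unraveling

end CondRew

namespace CondRew

/-! ### Rewriting with unconditional and conditional rules. -/

section Terms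

variable {L : FirstOrder.Language.{u, v}} {V : Type w}

/-! The proof carries an invariant, `Sound`, along the derivation: each subterm `U^α_i(a, v₁, …,
vₘ)` certifies that, for the substitution recorded in the `vⱼ` and read through `tb`, the conditions
before `i` hold and `sᵢ` rewrites to `tb a`. Innermost reduction makes this stable: the `vⱼ` are
normal forms when they are first stored, so later steps inside the U-term can only take place in
`a`, and they prolong the recorded derivation.

When `tᵢ` is matched, condition `i` holds too (`Sound.conds_of_matched`). Introduction and switch
steps leave `tb` unchanged (`tb_uPattern_subst`); an elimination step has all conditions certified
and becomes a single conditional step. `Sound.rootStep` treats the root, `Sound.innermostStep` the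
contexts. -/

theorem subst_var (t : L.Term V) : t.subst (fun x => .var x) = t := by
  induction t with
  | var x => rfl
  | func f ts ih => exact congrArg (Language.Term.func f) (funext ih)

theorem Replace.mono {ρ ρ' : L.Term V → L.Term V → Prop} (hρ : ∀ s t, ρ s t → ρ' s t)
    {s t : L.Term V} (h : Replace ρ s t) : Replace ρ' s t := by
  induction h with
  | here h => exact .here (hρ _ _ h)
  | inside f ts i _ ih => exact .inside f ts i ih

theorem InnermostStep.step {R : TRS L V} {s t : L.Term V} (h : InnermostStep R s t) :
    Step R s t :=
  Replace.mono (fun _ _ h => h.1) h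

theorem Step.mono {R S : TRS L V} (h : R ⊆ S) {s t : L.Term V} (hst : Step R s t) :
    Step S s t :=
  Replace.mono (fun _ _ ⟨p, hp, hσ⟩ => ⟨p, h hp, hσ⟩) hst

theorem CTRS.level_subset_succ (R : CTRS L V) (n : ℕ) : R.level n ⊆ R.level (n + 1) := by
  induction n with
  | zero => exact fun _ h => h.elim
  | succ n ih =>
    rintro _ ⟨α, hα, σ, hc, rfl⟩
    exact ⟨α, hα, σ, fun c hcα =>
      Relation.ReflTransGen.mono (fun _ _ => Step.mono ih) _ _ (hc c hcα), rfl⟩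

theorem CTRS.level_mono (R : CTRS L V) : Monotone R.level :=
  monotone_nat_of_le_succ R.level_subset_succ

theorem CTRS.exists_level_of_rewrites (R : CTRS L V) {s t : L.Term V}
    (h : Relation.ReflTransGen R.CStep s t) :
    ∃ n, Relation.ReflTransGen (Step (R.level n)) s t := by
  induction h with
  | refl => exact ⟨0, .refl⟩
  | tail _ h ih =>
    obtain ⟨m, hm⟩ := ih
    obtain ⟨n, hn⟩ := h
    exact ⟨max m n,
      (Relation.ReflTransGen.mono
        (fun _ _ => Step.mono (R.level_mono (le_max_left m n))) _ _ hm).tail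
        (hn.mono (R.level_mono (le_max_right m n)))⟩

/-- A rule has finitely many conditions and the levels increase, so one level serves all of them. -/
theorem CTRS.cStep_of_conds (R : CTRS L V) {α : CRule L V} (hα : α ∈ R) (σ : V → L.Term V)
    (h : ∀ c ∈ α.conds, Relation.ReflTransGen R.CStep (c.1.subst σ) (c.2.subst σ)) :
    R.CStep (α.lhs.subst σ) (α.rhs.subst σ) := by
  choose! n hn using fun c hc => R.exists_level_of_rewrites (h c hc)
  obtain ⟨N, hN⟩ : ∃ N, ∀ c ∈ α.conds, n c ≤ N := by
    obtain ⟨N, hN⟩ := (α.conds.finite_toSet.image n).bddAbove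
    exact ⟨N, fun c hc => hN ⟨c, hc, rfl⟩⟩
  -- The rules of a level are already instantiated by `σ`, so the root step uses the identity
  -- substitution.
  refine ⟨N + 1, .here ⟨_, ⟨α, hα, σ, fun c hc => ?_, rfl⟩, fun x => .var x, ?_, ?_⟩⟩
  · exact Relation.ReflTransGen.mono (fun _ _ => Step.mono (R.level_mono (hN c hc))) _ _ (hn c hc)
  · exact (subst_var _).symm
  · exact (subst_var _).symm

theorem CTRS.rewrites_update (R : CTRS L V) {n : ℕ} (f : L.Functions n) (ts : Fin n → L.Term V)
    (i : Fin n) {t : L.Term V} (h : Relation.ReflTransGen R.CStep (ts i) t) :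
    Relation.ReflTransGen R.CStep (.func f ts) (.func f (Function.update ts i t)) := by
  induction h with
  | refl => rw [Function.update_eq_self]
  | @tail b c _ hbc ih =>
    obtain ⟨m, hm⟩ := hbc
    refine ih.tail ⟨m, ?_⟩
    have := Replace.inside (ρ := RootStep (R.level m)) f (Function.update ts i b) i (t := c)
      (by rwa [Function.update_self])
    rwa [Function.update_idem] at this

theorem CTRS.rewrites_func (R : CTRS L V) {n : ℕ} (f : L.Functions n) (ts ts' : Fin n → L.Term V)
    (h : ∀ i, Relation.ReflTransGen R.CStep (ts i) (ts' i)) :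
    Relation.ReflTransGen R.CStep (.func f ts) (.func f ts') := by
  -- Rewrite the arguments one by one; `s` holds the indices already treated.
  suffices ∀ s : Finset (Fin n),
      Relation.ReflTransGen R.CStep (.func f ts) (.func f (s.piecewise ts' ts)) by
    simpa using this Finset.univ
  intro s
  induction s using Finset.induction_on with
  | empty => simpa using Relation.ReflTransGen.refl
  | insert i s hi ih =>
    rw [Finset.piecewise_insert]
    exact ih.trans (R.rewrites_update f _ i (by simpa [hi] using h i))

theorem CTRS.rewrites_subst (R : CTRS L V) (t : L.Term V) {σ τ : V → L.Term V}
    (h : ∀ x, Relation.ReflTransGen R.CStep (σ x) (τ x)) :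
    Relation.ReflTransGen R.CStep (t.subst σ) (t.subst τ) := by
  induction t with
  | var x => exact h x
  | func f ts ih => exact R.rewrites_func f _ _ ih

/-! ### Variables of conditional rules and the sets `Xᵢ`. -/

variable [DecidableEq V]

theorem subst_congr {t : L.Term V} {σ τ : V → L.Term V} (h : ∀ x ∈ t.varFinset, σ x = τ x) :
    t.subst σ = t.subst τ := by
  induction t with
  | var x => exact h x (by simp [Language.Term.varFinset])
  | func f ts ih =>
    simp only [Language.Term.subst]
    congr 1
    funext i
    exact ih i fun x hx => h x (Finset.mem_biUnion.2 ⟨i, Finset.mem_univ _, hx⟩)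

theorem mem_foldr_snd_iff (cs : List (L.Term V × L.Term V)) (x : V) :
    x ∈ cs.foldr (fun c X => c.2.varFinset ∪ X) ∅ ↔ ∃ c ∈ cs, x ∈ c.2.varFinset := by
  induction cs with
  | nil => simp
  | cons c cs ih => simp [ih]

theorem CRule.mem_bound {α : CRule L V} {m : ℕ} {x : V} :
    x ∈ α.bound m ↔ x ∈ α.lhs.varFinset ∨
      ∃ (j : ℕ) (hj : j < α.conds.length), j < m ∧ x ∈ (α.conds[j]).2.varFinset := by
  rw [CRule.bound, Finset.mem_union, mem_foldr_snd_iff]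
  refine or_congr_right ⟨?_, ?_⟩
  · rintro ⟨c, hc, hx⟩
    obtain ⟨j, hj, rfl⟩ := List.mem_iff_getElem.1 hc
    simp only [List.length_take, lt_min_iff] at hj
    exact ⟨j, hj.2, hj.1, by simpa using hx⟩
  · rintro ⟨j, hj, hjm, hx⟩
    exact ⟨_, List.mem_take_iff_getElem.2 ⟨j, by omega, rfl⟩, hx⟩

theorem CRule.bound_mono (α : CRule L V) : Monotone α.bound := by
  intro m n hmn x hx
  rw [CRule.mem_bound] at hx ⊢
  exact hx.imp_right fun ⟨j, hj, hjm, h⟩ => ⟨j, hj, hjm.trans_le hmn, h⟩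

theorem CRule.mem_bound_succ {α : CRule L V} {m : ℕ} (hm : m < α.conds.length) {x : V}
    (hx : x ∈ α.bound (m + 1)) : x ∈ α.bound m ∨ x ∈ (α.conds[m]).2.varFinset := by
  rw [CRule.mem_bound] at hx
  obtain hx | ⟨j, hj, hjm, hx⟩ := hx
  · exact .inl (CRule.mem_bound.2 (.inl hx))
  · obtain hjm | rfl := Nat.lt_succ_iff_lt_or_eq.1 hjm
    · exact .inl (CRule.mem_bound.2 (.inr ⟨j, hj, hjm, hx⟩))
    · exact .inr hx

theorem mem_foldr_vars_iff (cs : List (L.Term V × L.Term V)) (x : V) :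
    x ∈ cs.foldr (fun c X => c.1.varFinset ∪ c.2.varFinset ∪ X) ∅ ↔
      ∃ c ∈ cs, x ∈ c.1.varFinset ∨ x ∈ c.2.varFinset := by
  induction cs with
  | nil => simp
  | cons c cs ih => simp only [List.foldr_cons, Finset.mem_union, ih, List.exists_mem_cons_iff]

/-- Determinism places the variables of each `sⱼ` in `Xⱼ`, so the left-hand sides of the conditions
contribute nothing new. -/
theorem CRule.IsDeterministic.rhs_subset_bound {α : CRule L V} (h : α.IsDeterministic) :
    α.rhs.varFinset ⊆ α.bound α.conds.length := by
  intro x hx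
  obtain hx | hx := Finset.mem_union.1 (h.1 hx)
  · rw [CRule.condVars, mem_foldr_vars_iff, List.take_length] at hx
    obtain ⟨c, hc, hx⟩ := hx
    obtain ⟨j, hj, rfl⟩ := List.mem_iff_getElem.1 hc
    obtain hx | hx := hx
    · exact α.bound_mono hj.le (h.2 j hj hx)
    · exact CRule.mem_bound.2 (.inr ⟨j, hj, hj, hx⟩)
  · exact CRule.mem_bound.2 (.inl hx)

end Terms

section Unraveling

variable {L : FirstOrder.Language.{u, v}} {V : Type w} [DecidableEq V]
  {R : CTRS L V} {ord : VarOrder V}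

/-! ### Back-translation of instantiated rules. -/

@[simp]
theorem tb_orig (t : L.Term V) : tb (orig R ord t) = t := by
  induction t with
  | var x => rfl
  | func f ts ih => exact congrArg (Language.Term.func f) (funext ih)

theorem tb_orig_subst (t : L.Term V) (σ : V → MTerm R ord) :
    tb ((orig R ord t).subst σ) = t.subst fun x => tb (σ x) := by
  induction t with
  | var x => rfl
  | func f ts ih => exact congrArg (Language.Term.func f) (funext ih)

theorem bindVars_get (xs : List V) (σ : V → L.Term V) {x : V} (hx : x ∈ xs) :
    bindVars xs (fun j => σ (xs.get j)) x = σ x := by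
  simp [bindVars, hx]

theorem uPattern_subst (α : R) (i : Fin α.1.conds.length) (a : MTerm R ord)
    (σ : V → MTerm R ord) :
    (uPattern ord α i a).subst σ =
      uApp ord α i (a.subst σ) fun j => σ ((ord.list (α.1.bound i)).get j) := by
  simp only [uPattern, uApp, Language.Term.subst]
  congr 1
  funext j
  refine Fin.cases ?_ (fun j => ?_) j <;> simp [Language.Term.subst]

/-- Every `Xᵢ` contains `Var(l)`, so the stored arguments recover `lσ` whatever `i` and `a` are. -/
theorem tb_uPattern_subst (α : R) (i : Fin α.1.conds.length) (a : MTerm R ord)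
    (σ : V → MTerm R ord) :
    tb ((uPattern ord α i a).subst σ) = α.1.lhs.subst fun x => tb (σ x) := by
  rw [uPattern_subst]
  refine subst_congr fun x hx => ?_
  exact bindVars_get _ (fun x => tb (σ x))
    ((ord.mem_list _ _).2 (CRule.mem_bound.2 (.inl hx)))

theorem orig_subst_eq_or_properSubterm {t : L.Term V} {x : V} (hx : x ∈ t.varFinset)
    (σ : V → MTerm R ord) :
    t = .var x ∨ ProperSubterm (σ x) ((orig R ord t).subst σ) := by
  induction t with
  | var y => exact .inl (by simp_all [Language.Term.varFinset])
  | func f ts ih =>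
    obtain ⟨i, -, hx⟩ := Finset.mem_biUnion.1 hx
    right
    obtain h | h := ih i hx
    · have := ProperSubterm.arg (L := L.sum (uLang R ord)) (V := V) (Sum.inl f)
        (fun i => (orig R ord (ts i)).subst σ) i
      simp only [h] at this
      exact this
    · exact .deeper (L := L.sum (uLang R ord)) (Sum.inl f)
        (fun i => (orig R ord (ts i)).subst σ) i h

/-! ### The invariant. -/

/-- The term `U^α_i(a, v₁, …, vₘ)` records a successful evaluation of the first `i` conditions, and
a partial evaluation of the next one, for a substitution that maps `Xᵢ` to irreducible terms. -/
def Evaluates (α : R) (i : Fin α.1.conds.length) (a : MTerm R ord)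
    (vs : Fin (ord.list (α.1.bound i)).length → MTerm R ord) : Prop :=
  ∃ σ : V → MTerm R ord,
    (∀ j, vs j = σ ((ord.list (α.1.bound i)).get j)) ∧
    (∀ j, Irreducible (useq R ord) (vs j)) ∧
    (∀ (j : ℕ) (hj : j < α.1.conds.length), j < i →
      Relation.ReflTransGen R.CStep ((α.1.conds[j]).1.subst fun x => tb (σ x))
        ((α.1.conds[j]).2.subst fun x => tb (σ x))) ∧
    Relation.ReflTransGen R.CStep ((α.1.conds[i]).1.subst fun x => tb (σ x)) (tb a)

/-- Every subterm with a U-symbol at the root records an evaluation of conditions. If a left-hand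
side is a variable, then no term is irreducible, and nothing is required. -/
def Sound : MTerm R ord → Prop
  | .var _ => True
  | .func (.inl _) ts => ∀ i, Sound (ts i)
  | .func (.inr (.mk α i)) ts => (∀ j, Sound (ts j)) ∧
      ((∃ t, Irreducible (useq R ord) t) → Evaluates α i (ts 0) fun j => ts j.succ)

theorem sound_orig_subst {t : L.Term V} {σ : V → MTerm R ord} :
    Sound ((orig R ord t).subst σ) ↔ ∀ x ∈ t.varFinset, Sound (σ x) := by
  induction t with
  | var x => simp [orig, Language.Term.varFinset, Language.LHom.onTerm, Language.Term.subst]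
  | func f ts ih =>
    change (∀ i, Sound ((orig R ord (ts i)).subst σ)) ↔ _
    simp only [ih, Language.Term.varFinset, Finset.mem_biUnion, Finset.mem_univ, true_and]
    grind

theorem sound_orig (t : L.Term V) : Sound (orig R ord t) := by
  induction t with
  | var x => trivial
  | func f ts ih => exact ih

theorem sound_uPattern_subst {α : R} {i : Fin α.1.conds.length} {a : MTerm R ord}
    {σ : V → MTerm R ord} :
    Sound ((uPattern ord α i a).subst σ) ↔
      Sound (a.subst σ) ∧ (∀ x ∈ α.1.bound i, Sound (σ x)) ∧
      ((∃ t, Irreducible (useq R ord) t) → Evaluates α i (a.subst σ) fun j =>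
        σ ((ord.list (α.1.bound i)).get j)) := by
  rw [uPattern_subst, uApp]
  simp only [Sound, Fin.forall_fin_succ, Fin.cons_zero, Fin.cons_succ, and_assoc]
  refine and_congr_right fun _ => and_congr_left fun _ => ⟨fun h x hx => ?_, fun h j => ?_⟩
  · obtain ⟨j, rfl⟩ := List.mem_iff_get.1 ((ord.mem_list _ _).2 hx)
    exact h j
  · exact h _ ((ord.mem_list _ _).1 (List.get_mem _ _))

/-- An evaluation is determined by the values of `Xᵢ`. -/
theorem Evaluates.of_subst (hdet : R.IsDCTRS) {α : R} {i : Fin α.1.conds.length} {a : MTerm R ord}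
    {σ : V → MTerm R ord}
    (h : Evaluates α i a fun j => σ ((ord.list (α.1.bound i)).get j)) :
    (∀ x ∈ α.1.bound i, Irreducible (useq R ord) (σ x)) ∧
    (∀ (j : ℕ) (hj : j < α.1.conds.length), j < i →
      Relation.ReflTransGen R.CStep ((α.1.conds[j]).1.subst fun x => tb (σ x))
        ((α.1.conds[j]).2.subst fun x => tb (σ x))) ∧
    Relation.ReflTransGen R.CStep ((α.1.conds[i]).1.subst fun x => tb (σ x)) (tb a) := by
  obtain ⟨τ, hτ, hirr, hconds, hlast⟩ := h
  have hget : ∀ x ∈ α.1.bound i, ∃ j, (ord.list (α.1.bound i)).get j = x := fun x hx =>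
    List.mem_iff_get.1 ((ord.mem_list _ _).2 hx)
  have heq : ∀ x ∈ α.1.bound i, tb (τ x) = tb (σ x) := by
    intro x hx
    obtain ⟨j, rfl⟩ := hget x hx
    rw [← hτ j]
  refine ⟨fun x hx => ?_, fun j hj hji => ?_, ?_⟩
  · obtain ⟨j, rfl⟩ := hget x hx
    exact hirr j
  · have h := hconds j hj hji
    -- By determinism, `sⱼ` and `tⱼ` with `j < i` only use variables of `Xᵢ`, where `τ` and `σ`
    -- agree.
    rwa [subst_congr fun x hx => heq x (α.1.bound_mono hji.le ((hdet α.1 α.2).2 j hj hx)),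
      subst_congr fun x hx => heq x (CRule.mem_bound.2 (.inr ⟨j, hj, hji, hx⟩))] at h
  · have hi := subst_congr (t := (α.1.conds[i]).1) fun x hx =>
      heq x ((hdet α.1 α.2).2 i i.2 hx)
    rwa [hi] at hlast

theorem evaluates_zero {α : R} (h : 0 < α.1.conds.length) {σ : V → MTerm R ord}
    (hirr : ∀ x ∈ α.1.lhs.varFinset, Irreducible (useq R ord) (σ x)) :
    Evaluates α ⟨0, h⟩ ((orig R ord (α.1.conds[0]).1).subst σ) fun j =>
      σ ((ord.list (α.1.bound 0)).get j) := by
  refine ⟨σ, fun _ => rfl, fun j => hirr _ ?_, fun _ _ h => absurd h (Nat.not_lt_zero _), ?_⟩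
  · have := (ord.mem_list (α.1.bound 0) _).1 (List.get_mem _ j)
    simpa [CRule.bound] using this
  · rw [tb_orig_subst]
    rfl

/-! ### Preservation of the invariant by innermost steps. -/

/-- If a left-hand side is a variable, then every term is reducible. -/
theorem not_irreducible_of_lhs_eq_var {α : R} {x : V} (hx : α.1.lhs = .var x)
    (t : MTerm R ord) : ¬ Irreducible (useq R ord) t := by
  intro h
  obtain ⟨r, hr⟩ : ∃ r, UseqRule ord α (orig R ord α.1.lhs) r := by
    obtain h0 | h0 := Nat.eq_zero_or_pos α.1.conds.length
    · exact ⟨_, .unconditional (List.length_eq_zero_iff.1 h0)⟩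
    · exact ⟨_, .introduction h0⟩
  refine h (r.subst fun _ => t) (.here ⟨(_, r), ⟨α, hr⟩, fun _ => t, ?_, rfl⟩)
  simp [hx, Language.LHom.onTerm, Language.Term.subst]

theorem properSubterm_uApp (α : R) (i : Fin α.1.conds.length) (a : MTerm R ord)
    (vs : Fin (ord.list (α.1.bound i)).length → MTerm R ord) :
    ProperSubterm a (uApp ord α i a vs) := by
  have := ProperSubterm.arg (L := L.sum (uLang R ord)) (Sum.inr (USym.mk α i))
    (Fin.cons a vs : Fin _ → MTerm R ord) 0
  rwa [Fin.cons_zero] at this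

theorem ProperSubterm.uApp {α : R} {i : Fin α.1.conds.length} {s a : MTerm R ord}
    (h : ProperSubterm s a) (vs : Fin (ord.list (α.1.bound i)).length → MTerm R ord) :
    ProperSubterm s (uApp ord α i a vs) :=
  .deeper (L := L.sum (uLang R ord)) (Sum.inr (USym.mk α i)) (Fin.cons a vs : Fin _ → MTerm R ord)
    0 h

theorem properSubterm_uPattern {α : R} {i : Fin α.1.conds.length} {t : L.Term V}
    (σ : V → MTerm R ord) {x : V} (hx : x ∈ t.varFinset) :
    ProperSubterm (σ x) ((uPattern ord α i (orig R ord t)).subst σ) := by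
  rw [uPattern_subst]
  obtain rfl | h := orig_subst_eq_or_properSubterm hx σ
  · exact properSubterm_uApp α i _ _
  · exact h.uApp _

theorem properSubterm_uPattern_cond {α : R} {i : Fin α.1.conds.length} {a : MTerm R ord}
    (σ : V → MTerm R ord) :
    ProperSubterm (a.subst σ) ((uPattern ord α i a).subst σ) := by
  rw [uPattern_subst]
  exact properSubterm_uApp α i _ _

/-- Once the right-hand side of condition `i` is matched, the first `i + 1` conditions hold. -/
theorem Sound.conds_of_matched (hdet : R.IsDCTRS) {α : R} {i : Fin α.1.conds.length}
    {σ : V → MTerm R ord}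
    (hs : Sound ((uPattern ord α i (orig R ord (α.1.conds[i]).2)).subst σ))
    (hin : ∀ w, ProperSubterm w ((uPattern ord α i (orig R ord (α.1.conds[i]).2)).subst σ) →
      Irreducible (useq R ord) w) :
    (∀ x ∈ α.1.bound (i + 1), Sound (σ x) ∧ Irreducible (useq R ord) (σ x)) ∧
    ∀ (j : ℕ) (hj : j < α.1.conds.length), j < (i : ℕ) + 1 →
      Relation.ReflTransGen R.CStep ((α.1.conds[j]).1.subst fun x => tb (σ x))
        ((α.1.conds[j]).2.subst fun x => tb (σ x)) := by
  obtain ⟨hcond, hvars, heval⟩ := sound_uPattern_subst.1 hs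
  obtain ⟨hirr, hconds, hlast⟩ :=
    -- The conditional argument of the redex is itself the irreducible term that `Sound` asks for.
    (heval ⟨_, hin _ (properSubterm_uPattern_cond σ)⟩).of_subst hdet
  refine ⟨fun x hx => ?_, fun j hj hji => ?_⟩
  · obtain hx | hx := CRule.mem_bound_succ i.2 hx
    · exact ⟨hvars x hx, hirr x hx⟩
    · exact ⟨sound_orig_subst.1 hcond x hx, hin _ (properSubterm_uPattern σ hx)⟩
  · obtain hji | rfl := Nat.lt_succ_iff_lt_or_eq.1 hji
    · exact hconds j hj hji
    · rw [tb_orig_subst] at hlast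
      exact hlast

theorem Sound.rootStep (hdet : R.IsDCTRS) {s t : MTerm R ord} (hs : Sound s)
    (h : RootStep (useq R ord) s t)
    (hin : ∀ w, ProperSubterm w s → Irreducible (useq R ord) w) :
    Sound t ∧ Relation.ReflTransGen R.CStep (tb s) (tb t) := by
  obtain ⟨⟨l, r⟩, ⟨α, hα⟩, σ, rfl, rfl⟩ := h
  have hα' := hdet α.1 α.2
  dsimp only at hα hs hin ⊢
  cases hα with
  | unconditional h0 =>
    rw [sound_orig_subst] at hs ⊢
    rw [tb_orig_subst, tb_orig_subst]
    refine ⟨fun x hx => hs x ?_, .single (R.cStep_of_conds α.2 _ (by simp [h0]))⟩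
    simpa [CRule.bound, h0] using hα'.rhs_subset_bound hx
  | introduction h0 =>
    rw [sound_orig_subst] at hs
    have hb : ∀ x ∈ α.1.bound 0, Sound (σ x) := fun x hx => hs x (by simpa [CRule.bound] using hx)
    refine ⟨sound_uPattern_subst.2 ⟨sound_orig_subst.2 fun x hx => hb x (hα'.2 0 h0 hx), hb,
      fun ⟨w, hw⟩ => evaluates_zero h0 fun x hx => ?_⟩, ?_⟩
    · obtain h | h := orig_subst_eq_or_properSubterm hx σ
      -- Here `σ x` is the whole redex, so innermostness says nothing about it; the guard in `Sound`
      -- excludes this case.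
      · exact absurd hw (not_irreducible_of_lhs_eq_var h w)
      · exact hin _ h
    · rw [tb_orig_subst, tb_uPattern_subst]
  | switch i hi =>
    obtain ⟨hvars, hconds⟩ := Sound.conds_of_matched (i := ⟨i, Nat.lt_of_succ_lt hi⟩) hdet hs hin
    refine ⟨sound_uPattern_subst.2 ⟨sound_orig_subst.2 fun x hx =>
      (hvars x (hα'.2 (i + 1) hi hx)).1, fun x hx => (hvars x hx).1, fun _ =>
      ⟨σ, fun _ => rfl, fun j => (hvars _ ?_).2, hconds, ?_⟩⟩, ?_⟩
    · exact (ord.mem_list _ _).1 (List.get_mem _ j)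
    · rw [tb_orig_subst]
      rfl
    · rw [tb_uPattern_subst, tb_uPattern_subst]
  | elimination i hi hlast =>
    obtain ⟨hvars, hconds⟩ := Sound.conds_of_matched (i := ⟨i, hi⟩) hdet hs hin
    refine ⟨sound_orig_subst.2 fun x hx =>
      (hvars x (by simpa [hlast] using hα'.rhs_subset_bound hx)).1, ?_⟩
    rw [tb_uPattern_subst, tb_orig_subst]
    -- The last condition has just been matched, so `hconds` covers all of them.
    refine .single (R.cStep_of_conds α.2 _ fun c hc => ?_)
    obtain ⟨j, hj, rfl⟩ := List.mem_iff_getElem.1 hc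
    exact hconds j hj (hj.trans_eq hlast.symm)

theorem Sound.innermostStep (hdet : R.IsDCTRS) {s t : MTerm R ord}
    (h : InnermostStep (useq R ord) s t) :
    Sound s → Sound t ∧ Relation.ReflTransGen R.CStep (tb s) (tb t) := by
  induction h with
  | here h => exact fun hs => hs.rootStep hdet h.1 h.2
  | @inside n f ts i t h ih =>
    intro hs
    have hts : ∀ j, Sound (ts j) := by
      rcases f with f | ⟨α, k⟩
      exacts [hs, hs.1]
    obtain ⟨ht, hstep⟩ := ih (hts i)
    have hts' : ∀ j, Sound (Function.update ts i t j) := by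
      intro j
      obtain rfl | hj := eq_or_ne j i
      · simpa using ht
      · simpa [hj] using hts j
    have htb : ∀ j, Relation.ReflTransGen R.CStep (tb (ts j)) (tb (Function.update ts i t j)) := by
      intro j
      obtain rfl | hj := eq_or_ne j i
      · simpa using hstep
      · simpa [hj] using Relation.ReflTransGen.refl
    rcases f with f | ⟨α, k⟩
    · exact ⟨hts', R.rewrites_func f _ _ htb⟩
    -- `tb` sees only the variable arguments of a U-term, as values of a substitution applied to
    -- `l`.
    · refine ⟨⟨hts', fun hirr => ?_⟩, R.rewrites_subst _ fun x => ?_⟩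
      · obtain ⟨σ, hσ, hvs, hconds, hlast⟩ := hs.2 hirr
        have hsucc : ∀ j : Fin _, Function.update ts i t j.succ = ts j.succ := by
          intro j
          refine Function.update_of_ne ?_ _ _
          rintro rfl
          -- A step in a variable argument would contradict its irreducibility.
          exact hvs j _ (InnermostStep.step h)
        simp only [hsucc]
        exact ⟨σ, hσ, hvs, hconds, hlast.trans (htb 0)⟩
      · unfold bindVars
        split
        · exact htb _
        · exact .refl

end Unraveling

end CondRew

theorem mainTheorem2 {L : FirstOrder.Language.{u, v}} {V : Type w} [DecidableEq V]
    (ord : CondRew.VarOrder V) (R : CondRew.CTRS L V)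
    (hdet : R.IsDCTRS) (hstable : R.IsRightStable) (s : L.Term V) :
    (∀ t : CondRew.MTerm R ord,
      Relation.ReflTransGen (CondRew.InnermostStep (CondRew.useq R ord))
        (CondRew.orig R ord s) t →
      Relation.ReflTransGen R.CStep s (CondRew.tb t)) ∧
    (∀ t : L.Term V,
      Relation.ReflTransGen (CondRew.InnermostStep (CondRew.useq R ord))
        (CondRew.orig R ord s) (CondRew.orig R ord t) →
      Relation.ReflTransGen R.CStep s t) := by
  have key : ∀ t : CondRew.MTerm R ord,
      Relation.ReflTransGen (CondRew.InnermostStep (CondRew.useq R ord))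
        (CondRew.orig R ord s) t →
      CondRew.Sound t ∧ Relation.ReflTransGen R.CStep s (CondRew.tb t) := by
    intro t h
    induction h with
    | refl => exact ⟨CondRew.sound_orig s, by rw [CondRew.tb_orig]⟩
    | tail _ h ih =>
      obtain ⟨hsound, hstep⟩ := CondRew.Sound.innermostStep hdet h ih.1
      exact ⟨hsound, ih.2.trans hstep⟩
  refine ⟨fun t h => (key t h).2, fun t h => ?_⟩
  simpa using (key _ h).2
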